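/- Let $m\ge 1$, $n_1,\dots,n_m\ge 1$ and $n=n_1+\dots+n_m$. Consider the interconnected time-varying system $$\dot x_i=f_i(t,x_1,\dots,x_m),\qquad t\ge t_0,\quad x_i\in\mathbb R^{n_i},\quad i=1,\dots,m,$$ written $\dot x=f(t,x)$ with $x=(x_1,\dots,x_m)\in\mathbb R^n$. Assume that $f(t,\cdot)$ is continuously differentiable for each $t\ge t_0$, that $f$ and its Jacobian $\partial_x f$ are piecewise continuous in $t$ (continuous in $(t,x)$ on $[t_0,\infty)\times\mathbb R^n$ away from a locally finite set of times, with limits from the left and from the right, jointly in $(t,x)$, at these times), and that for each $x\in\mathbb R^n$ the solution $\xi(t,t_0,x)$ with $\xi(t_0,t_0,x)=x$ exists for all $t\ge t_0$. Here a solution is continuous and satisfies the equation away from a locally finite set of times. Let $K\subset\mathbb R^n$ be compact with nonempty interior, and let $\xi(t,t_0,K)=\{\xi(t,t_0,x):x\in K\}$ be the reachable set. Let $|\cdot|$ be any norm on $\mathbb R^n$. For $T\ge0$ and $\varepsilon>0$ let $S(f,t_0,\varepsilon,T,K)$ be the minimal cardinality of a set $E\subset K$ such that for every $\bar x\in K$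 there is $x\in E$ with $|\xi(t,t_0,\bar x)-\xi(t,t_0,x)|<\varepsilon$ for all $t\in[t_0,t_0+T]$. The topological entropy is $$h(f,t_0,K)=\lim_{\varepsilon\searrow0}\limsup_{T\to\infty}\frac1T\log S(f,t_0,\varepsilon,T,K).$$ For each $i$ let $|\cdot|_i$ be a norm on $\mathbb R^{n_i}$, with induced norm $\|\cdot\|_i$ on $\mathbb R^{n_i\times n_i}$ and matrix measure $\mu_i(B)=\lim_{s\searrow0}(\|I+sB\|_i-1)/s$. For $B\in\mathbb R^{n_i\times n_j}$ let $\|B\|_{ij}=\max_{|v|_j=1}|Bv|_i$. Define the interconnection matrix function $A_{\mathrm N}(t,x)=[a_{ij}(t,x)]\in\mathbb R^{m\times m}$ by $$a_{ii}(t,x)=\mu_i\bigl(\partial_{x_i}f_i(t,x)\bigr),\qquad a_{ij}(t,x)=\bigl\|\partial_{x_j}f_i(t,x)\bigr\|_{ij}\quad(i\ne j).$$ Suppose that $\hat A_{\mathrm N}=[\hat a_{ij}]\in\mathbb R^{m\times m}$ is a Metzler matrix (its off-diagonal entries are nonnegative) such that $$\hat a_{ij}\ \ge\ \limsup_{t\to\infty}\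 \max_{v\in\operatorname{co}(\xi(t,t_0,K))}a_{ij}(t,v)\qquad\text{for all } i,j\in\{1,\dots,m\},$$ where $\operatorname{co}$ denotes the convex hull. Then $$h(f,t_0,K)\ \le\ n\,\max\{\alpha(\hat A_{\mathrm N}),\,0\},$$ where $\alpha(\hat A_{\mathrm N})$ is the largest real part of the eigenvalues of $\hat A_{\mathrm N}$. -/

import Mathlib

open Set Filter Topology

noncomputable section

section System

variable {V : Type*} [NormedAddCommGroup V] [NormedSpace ℝ V]

/-- `D` has only finitely many points in each bounded interval `[t₀, b]`. -/
def LocallyFiniteAfter (t₀ : ℝ) (D : Set ℝ) : Prop :=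
  ∀ b : ℝ, (D ∩ Icc t₀ b).Finite

/-- A function `F (t, x)` is piecewise continuous in `t` on `[t₀, ∞)` (and continuous in `x`): on the
strips between consecutive points of a locally finite set of times it is continuous in `(t, x)`, and
it has continuous one-sided limits at these times. The values of `F` at the exceptional times are
not restricted here. -/
def PiecewiseContinuousInTime {W : Type*} [TopologicalSpace W] (t₀ : ℝ) (F : ℝ → V → W) : Prop :=
  ∃ D : Set ℝ, LocallyFiniteAfter t₀ D ∧
    (∀ t, t₀ ≤ t → t ∉ D → ∀ x : V,
      ContinuousWithinAt (fun q : ℝ × V => F q.1 q.2) (Ici t₀ ×ˢ univ) (t, x)) ∧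
    (∀ t, t₀ ≤ t → ∀ x : V, ∃ y : W,
      Tendsto (fun q : ℝ × V => F q.1 q.2) (𝓝[>] t ×ˢ 𝓝 x) (𝓝 y)) ∧
    (∀ t, t₀ < t → ∀ x : V, ∃ y : W,
      Tendsto (fun q : ℝ × V => F q.1 q.2) (𝓝[<] t ×ˢ 𝓝 x) (𝓝 y))

/-- `φ` solves `ẋ = f (t, x)` for `t ≥ t₀` with `φ t₀ = x₀`: it is continuous, and the equation holds
away from a locally finite set of times. -/
def IsSolution (f : ℝ → V → V) (t₀ : ℝ) (x₀ : V) (φ : ℝ → V) : Prop :=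
  φ t₀ = x₀ ∧ ContinuousOn φ (Ici t₀) ∧
    ∃ D : Set ℝ, LocallyFiniteAfter t₀ D ∧
      ∀ t, t₀ < t → t ∉ D → HasDerivAt φ (f t (φ t)) t

/-- Standing assumptions on `ẋ = f (t, x)`, `t ≥ t₀`: `f` is piecewise continuous in `t` and
continuously differentiable in `x` (the Jacobian being again piecewise continuous in `t`), and each
initial state has a solution on all of `[t₀, ∞)`. -/
structure IsForwardCompleteSystem (f : ℝ → V → V) (t₀ : ℝ) : Prop where
  piecewiseContinuous : PiecewiseContinuousInTime t₀ f
  contDiff : ∀ t, t₀ ≤ t → ContDiff ℝ 1 (f t)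
  piecewiseContinuous_fderiv : PiecewiseContinuousInTime t₀ (fun t x => fderiv ℝ (f t) x)
  exists_solution : ∀ x : V, ∃ φ : ℝ → V, IsSolution f t₀ x φ

open Classical in
/-- `ξ (t, t₀, x)`: the solution at time `t` with state `x` at time `t₀`. (The value is a default one
if there is no solution on `[t₀, ∞)`.) -/
def flow (f : ℝ → V → V) (t₀ t : ℝ) (x : V) : V :=
  if h : ∃ φ : ℝ → V, IsSolution f t₀ x φ then h.choose t else x

/-- `ξ (t, t₀, K)`. -/
def reachableSet (f : ℝ → V → V) (t₀ : ℝ) (K : Set V) (t : ℝ) : Set V :=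
  flow f t₀ t '' K

/-- The ball `B (x, ε, T)` of states whose trajectories stay `ε`-close, with respect to the norm `p`,
to the one of `x` on `[t₀, t₀ + T]`. -/
def dynBall (p : Seminorm ℝ V) (f : ℝ → V → V) (t₀ : ℝ) (x : V) (ε T : ℝ) : Set V :=
  {y | ∀ t ∈ Icc t₀ (t₀ + T), p (flow f t₀ t y - flow f t₀ t x) < ε}

/-- `E ⊆ K` is `(T, ε)`-spanning for `K`. -/
def IsSpanning (p : Seminorm ℝ V) (f : ℝ → V → V) (t₀ ε T : ℝ) (K E : Set V) : Prop :=
  E ⊆ K ∧ K ⊆ ⋃ x ∈ E, dynBall p f t₀ x ε T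

/-- Minimal cardinality of a `(T, ε)`-spanning set. -/
def spanningNumber (p : Seminorm ℝ V) (f : ℝ → V → V) (t₀ ε T : ℝ) (K : Set V) : ℕ∞ :=
  sInf {k : ℕ∞ | ∃ E : Set V, IsSpanning p f t₀ ε T K E ∧ E.encard = k}

/-- Topological entropy `h (f, t₀, K)`, an extended real number. The limit over `ε ↘ 0` exists in
`[-∞, ∞]`, as the upper limit is nonincreasing in `ε`. -/
def topEntropy (p : Seminorm ℝ V) (f : ℝ → V → V) (t₀ : ℝ) (K : Set V) : EReal :=
  limUnder (𝓝[>] (0 : ℝ)) fun ε : ℝ =>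
    limsup (fun T : ℝ =>
      ((1 / T : ℝ) : EReal) * ENNReal.log ((spanningNumber p f t₀ ε T K : ℕ∞) : ENNReal)) atTop

/-- Matrix measure (logarithmic norm) of `A` with respect to the operator norm. -/
def matrixMeasure (A : V →L[ℝ] V) : ℝ :=
  limUnder (𝓝[>] (0 : ℝ)) fun s : ℝ => (‖ContinuousLinearMap.id ℝ V + s • A‖ - 1) / s

end System

section Interconnection

variable {m : ℕ} {E : Fin m → Type*} [∀ i, NormedAddCommGroup (E i)] [∀ i, NormedSpace ℝ (E i)]

/-- The Jacobian block of `f_i (t, x)` with respect to `x_j`. -/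
def jacobianBlock (f : ℝ → (∀ i, E i) → (∀ i, E i)) (t : ℝ) (x : ∀ i, E i) (i j : Fin m) :
    E j →L[ℝ] E i :=
  (ContinuousLinearMap.proj i).comp
    ((fderiv ℝ (f t) x).comp (ContinuousLinearMap.single ℝ E j))

/-- The interconnection matrix function: local matrix measures on the diagonal, mixed induced norms
off the diagonal. The local norm of the `i`-th subsystem is the norm of `E i`. -/
def interconnectionMatrix (f : ℝ → (∀ i, E i) → (∀ i, E i)) (t : ℝ) (x : ∀ i, E i) :
    Matrix (Fin m) (Fin m) ℝ :=
  Matrix.of fun i j =>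
    if i = j then matrixMeasure (jacobianBlock f t x i i) else ‖jacobianBlock f t x i j‖

/-- A Metzler matrix: nonnegative off-diagonal entries. -/
def IsMetzler (M : Matrix (Fin m) (Fin m) ℝ) : Prop :=
  ∀ i j, i ≠ j → 0 ≤ M i j

/-- Largest real part of the complex eigenvalues of a real matrix. -/
def spectralAbscissa (M : Matrix (Fin m) (Fin m) ℝ) : ℝ :=
  sSup (Complex.re '' spectrum ℂ (M.map Complex.ofReal))

end Interconnection

end

/-! Fix a rate c > max(α(A), 0). Since A is Metzler, there is a positive vector u with A u < c u
(`IsMetzler.exists_pos_mulVec_lt`), and the strict inequality leaves room to add some δ > 0 to every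
entry of A. From some time t₁ on, A + δ dominates the interconnection matrices on the convex hull of
the reachable set, hence along the segment joining any two trajectories.

In the weighted maximum norm max_i |z_i|_i / u_i, a small Euler step of length s then stretches the
difference of two trajectories by at most 1 + s c (`eventually_norm_rescale_euler_le`), and a
Gronwall argument gives growth exp(c (t - t₁)). Up to t₁ the flow is Lipschitz on K. Hence distances
on K grow at most like C exp(c (t - t₀)).

Because c ≥ 0, points of K at distance of order ε exp(-c T) stay ε-close on the whole window of
length T. A net at that scale has O(exp(n c T)) points for fixed ε
(`IsCompact.exists_net_encard_le`), so the entropy is at most n c (`topEntropy_le_finrank_mul`).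
Finally c decreases to max(α(A), 0). -/

/-! ### Positive subeigenvectors of Metzler matrices. -/

section MetzlerMatrices

variable {m : ℕ}

/-- A real number to the right of the spectral abscissa is not an eigenvalue. -/
lemma det_smul_one_sub_ne_zero {A : Matrix (Fin m) (Fin m) ℝ} {s : ℝ}
    (hs : spectralAbscissa A < s) : (s • (1 : Matrix (Fin m) (Fin m) ℝ) - A).det ≠ 0 := by
  intro hdet
  refine hs.not_ge (le_csSup ((Matrix.finite_spectrum _).image _).bddAbove ⟨(s : ℂ), ?_, by simp⟩)
  rw [spectrum.mem_iff, Matrix.isUnit_iff_isUnit_det, isUnit_iff_ne_zero, not_not]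
  have h : algebraMap ℂ (Matrix (Fin m) (Fin m) ℂ) s - A.map Complex.ofReal
      = (s • (1 : Matrix (Fin m) (Fin m) ℝ) - A).map (Complex.ofRealHom) := by
    ext i j
    by_cases hij : i = j
    · subst hij
      simp [Matrix.algebraMap_matrix_apply]
    · simp [Matrix.algebraMap_matrix_apply, hij]
  rw [h, ← RingHom.mapMatrix_apply, ← RingHom.map_det, hdet, map_zero]

/-- Row `i` of `(s - A) u = 1` for a Metzler matrix `A`, at an index `i` where `u` attains its
minimum `b`. -/
lemma IsMetzler.one_le_mul {A : Matrix (Fin m) (Fin m) ℝ} (hA : IsMetzler A) {s : ℝ}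
    {u : Fin m → ℝ} {i : Fin m} {b : ℝ} (hu : s * u i - A.mulVec u i = 1)
    (hb : ∀ j, b ≤ u j) (hi : u i = b) : 1 ≤ (s - ∑ j, A i j) * b := by
  -- Off the diagonal, nonnegative entries allow `u j` to be lowered to `b`. On the diagonal `u i =
  -- b` exactly, so the sign of `A i i` does not matter.
  have h : (∑ j, A i j) * b ≤ A.mulVec u i := by
    rw [Finset.sum_mul]
    refine Finset.sum_le_sum fun j _ => ?_
    by_cases hij : i = j
    · subst hij
      rw [hi]
    · exact mul_le_mul_of_nonneg_left (hb j) (hA i j hij)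
  rw [hi] at hu
  linarith

/-- A Metzler matrix has a positive strict subeigenvector for each number to the right of its
spectral abscissa. -/
lemma IsMetzler.exists_pos_mulVec_lt (hm : 1 ≤ m) {A : Matrix (Fin m) (Fin m) ℝ}
    (hA : IsMetzler A) {c : ℝ} (hc : spectralAbscissa A < c) :
    ∃ u : Fin m → ℝ, (∀ i, 0 < u i) ∧ ∀ i, A.mulVec u i < c * u i := by
  have : Nonempty (Fin m) := ⟨⟨0, hm⟩⟩
  set B : ℝ → Matrix (Fin m) (Fin m) ℝ := fun s => s • 1 - A with hB
  -- Cramer's rule for the solution of (s - A) u = 1, which makes continuity in s visible.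
  set u : ℝ → Fin m → ℝ := fun s => (B s).det⁻¹ • (B s).adjugate.mulVec 1 with hu
  have hBc : Continuous B := by fun_prop
  have huc : ∀ i, ContinuousOn (fun s => u s i) (Ici c) := by
    intro i
    have h1 : Continuous fun s => (B s).adjugate.mulVec 1 i :=
      (continuous_apply i).comp (hBc.matrix_adjugate.matrix_mulVec continuous_const)
    exact (hBc.matrix_det.continuousOn.inv₀ fun s hs =>
      det_smul_one_sub_ne_zero (hc.trans_le hs)).mul h1.continuousOn
  have hsol : ∀ s ∈ Ici c, ∀ i, s * u s i - A.mulVec (u s) i = 1 := by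
    intro s hs i
    have h : (B s).mulVec (u s) = 1 := by
      simp only [hu]
      rw [Matrix.mulVec_smul, Matrix.mulVec_mulVec, Matrix.mul_adjugate, Matrix.smul_mulVec,
        Matrix.one_mulVec, smul_smul,
        inv_mul_cancel₀ (det_smul_one_sub_ne_zero (hc.trans_le hs)), one_smul]
    have h' := congrFun h i
    simpa [hB, Matrix.sub_mulVec, Matrix.smul_mulVec] using h'
  -- The smallest entry never vanishes on [c, ∞) and is positive once s exceeds all row sums, so by
  -- the intermediate value theorem it is positive already at c.
  set μ : ℝ → ℝ := fun s => Finset.univ.inf' Finset.univ_nonempty fun i => u s i with hμ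
  have hμc : ContinuousOn μ (Ici c) := ContinuousOn.finset_inf'_apply _ fun i _ => huc i
  have hkey : ∀ s ∈ Ici c, ∃ i, 1 ≤ (s - ∑ j, A i j) * μ s := by
    intro s hs
    obtain ⟨i, -, hi⟩ := Finset.exists_mem_eq_inf' Finset.univ_nonempty fun i => u s i
    exact ⟨i, hA.one_le_mul (hsol s hs i) (fun j => Finset.inf'_le _ (Finset.mem_univ j)) hi.symm⟩
  have hne : ∀ s ∈ Ici c, μ s ≠ 0 := by
    intro s hs h0
    obtain ⟨i, hi⟩ := hkey s hs
    rw [h0] at hi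
    linarith
  have hpos : 0 < μ c := by
    by_contra! hle
    obtain ⟨s, hcs, hs⟩ : ∃ s, c ≤ s ∧ ∀ i, ∑ j, A i j < s := by
      have hbd := ((Set.finite_range fun i => ∑ j, A i j).bddAbove)
      obtain ⟨M, hM⟩ := hbd
      exact ⟨max c (M + 1), le_max_left _ _, fun i =>
        (lt_of_le_of_lt (hM ⟨i, rfl⟩) (lt_add_one M)).trans_le (le_max_right _ _)⟩
    have hμs : 0 < μ s := by
      obtain ⟨i, hi⟩ := hkey s hcs
      have := hs i
      by_contra! hle'
      nlinarith
    obtain ⟨r, hr, hr0⟩ := isPreconnected_Ici.intermediate_value self_mem_Ici hcs hμc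
      ⟨hle, hμs.le⟩
    exact hne r hr hr0
  refine ⟨u c, fun i => hpos.trans_le (Finset.inf'_le _ (Finset.mem_univ i)), fun i => ?_⟩
  have := hsol c self_mem_Ici i
  linarith

/-- The strict inequality of a positive subeigenvector survives a small increase of the entries. -/
lemma exists_pos_forall_mulVec_add_le {A : Matrix (Fin m) (Fin m) ℝ} {u : Fin m → ℝ} {c : ℝ}
    (h : ∀ i, A.mulVec u i < c * u i) :
    ∃ δ > 0, ∀ i, ∑ j, (A i j + δ) * u j ≤ c * u i := by
  have hev : ∀ᶠ δ in 𝓝[>] (0 : ℝ), ∀ i, ∑ j, (A i j + δ) * u j < c * u i := by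
    rw [eventually_all]
    intro i
    have hcont : Continuous fun δ : ℝ => ∑ j, (A i j + δ) * u j := by fun_prop
    refine nhdsWithin_le_nhds (hcont.tendsto 0 |>.eventually_lt_const ?_)
    simpa [Matrix.mulVec, dotProduct] using h i
  obtain ⟨δ, hδ, hδ0⟩ := (hev.and self_mem_nhdsWithin).exists
  exact ⟨δ, hδ0, fun i => (hδ i).le⟩

end MetzlerMatrices

/-! ### Matrix measures. -/

section MatrixMeasure

variable {V : Type*} [NormedAddCommGroup V] [NormedSpace ℝ V]

/-- The difference quotients that define the matrix measure are nondecreasing. -/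
lemma norm_id_add_smul_sub_one_div_mono (B : V →L[ℝ] V) :
    MonotoneOn (fun s : ℝ => (‖ContinuousLinearMap.id ℝ V + s • B‖ - 1) / s) (Ioi 0) := by
  intro s hs r hr hsr
  have hs' : (0 : ℝ) < s := hs
  have hr' : (0 : ℝ) < r := hr
  have hle : s / r ≤ 1 := (div_le_one hr').2 hsr
  -- I + sB is a convex combination of I and I + rB, so monotonicity comes from convexity of the
  -- norm.
  have hdecomp : ContinuousLinearMap.id ℝ V + s • B
      = (1 - s / r) • ContinuousLinearMap.id ℝ V
        + (s / r) • (ContinuousLinearMap.id ℝ V + r • B) := by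
    rw [smul_add, smul_smul, div_mul_cancel₀ _ hr'.ne', ← add_assoc, ← add_smul]
    simp
  have h : ‖ContinuousLinearMap.id ℝ V + s • B‖
      ≤ (1 - s / r) + (s / r) * ‖ContinuousLinearMap.id ℝ V + r • B‖ := by
    conv_lhs => rw [hdecomp]
    refine (norm_add_le _ _).trans (add_le_add ?_ ?_)
    · rw [norm_smul, Real.norm_of_nonneg (by linarith)]
      exact mul_le_of_le_one_right (by linarith) ContinuousLinearMap.norm_id_le
    · rw [norm_smul, Real.norm_of_nonneg (by positivity)]
  change (_ - 1) / s ≤ (_ - 1) / r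
  rw [div_le_div_iff₀ hs' hr']
  have h2 := mul_le_mul_of_nonneg_right h hr'.le
  have h3 : ((1 - s / r) + (s / r) * ‖ContinuousLinearMap.id ℝ V + r • B‖) * r
      = r - s + s * ‖ContinuousLinearMap.id ℝ V + r • B‖ := by field_simp
  rw [h3] at h2
  linarith

/-- Monotone quotients bounded below by -‖B‖ converge, so the `limUnder` in the definition is a true
limit. On the zero space ‖I‖ = 0 and the quotients diverge. -/
lemma tendsto_matrixMeasure [Nontrivial V] (B : V →L[ℝ] V) :
    Tendsto (fun s : ℝ => (‖ContinuousLinearMap.id ℝ V + s • B‖ - 1) / s) (𝓝[>] 0)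
      (𝓝 (matrixMeasure B)) := by
  refine tendsto_nhds_limUnder ⟨_, (norm_id_add_smul_sub_one_div_mono B).tendsto_nhdsGT
    ⟨-‖B‖, ?_⟩⟩
  rintro _ ⟨s, hs, rfl⟩
  have hs' : (0 : ℝ) < s := hs
  change -‖B‖ ≤ (_ - 1) / s
  rw [le_div_iff₀ hs']
  have h := norm_sub_le (ContinuousLinearMap.id ℝ V + s • B) (s • B)
  rw [add_sub_cancel_right, ContinuousLinearMap.norm_id, norm_smul,
    Real.norm_of_nonneg hs'.le] at h
  linarith

/-- A strict bound on the matrix measure bounds `‖I + s B‖` to first order, locally uniformly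
in `B`. -/
lemma exists_forall_norm_id_add_smul_le [Nontrivial V] {B : V →L[ℝ] V} {c : ℝ}
    (h : matrixMeasure B < c) :
    ∃ r > 0, ∀ᶠ B' in 𝓝 B, ∀ s ∈ Ioc (0 : ℝ) r,
      ‖ContinuousLinearMap.id ℝ V + s • B'‖ ≤ 1 + s * c := by
  -- One step size suffices: at fixed r the quotient is continuous in the operator, and monotonicity
  -- carries the bound to all smaller steps.
  obtain ⟨r, hr, hr0⟩ :=
    (((tendsto_matrixMeasure B).eventually_lt_const h).and self_mem_nhdsWithin).exists
  have hr0' : (0 : ℝ) < r := hr0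
  refine ⟨r, hr0', ?_⟩
  have hcont : Continuous fun B' : V →L[ℝ] V =>
      (‖ContinuousLinearMap.id ℝ V + r • B'‖ - 1) / r := by fun_prop
  filter_upwards [(hcont.tendsto B).eventually_lt_const hr] with B' hB' s hs
  have h1 := norm_id_add_smul_sub_one_div_mono B' hs.1 hr0' hs.2
  have h2 := h1.trans hB'.le
  rw [div_le_iff₀ hs.1] at h2
  linarith

end MatrixMeasure

/-! ### Gronwall estimates with exceptional times. -/

section GronwallWithExceptions

/-- Exponential growth bound from a bound on the lower right Dini derivative, on an open interval. -/
lemma le_mul_exp_of_dini {u : ℝ → ℝ} {c a b : ℝ} (hab : a ≤ b) (hu : ContinuousOn u (Icc a b))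
    (h : ∀ t ∈ Ioo a b, ∀ r, c * u t < r → ∃ᶠ z in 𝓝[>] t, (z - t)⁻¹ * (u z - u t) < r) :
    u b ≤ u a * Real.exp (c * (b - a)) := by
  rcases hab.eq_or_lt with rfl | hlt
  · simp
  -- Nothing is assumed about the derivative at `a`, so the estimate starts at s > a and then s
  -- tends to a.
  have hin : ∀ s ∈ Ioo a b, u b ≤ u s * Real.exp (c * (b - s)) := by
    intro s hs
    have hsub : Icc s b ⊆ Icc a b := Icc_subset_Icc_left hs.1.le
    have := le_gronwallBound_of_liminf_deriv_right_le (f' := fun t => c * u t) (ε := 0) (K := c)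
      (hu.mono hsub) (fun t ht => h t ⟨hs.1.trans_le ht.1, ht.2⟩) le_rfl (by simp) b
      (right_mem_Icc.2 hs.2.le)
    rwa [gronwallBound_ε0] at this
  have htend : Tendsto (fun s => u s * Real.exp (c * (b - s))) (𝓝[Ioo a b] a)
      (𝓝 (u a * Real.exp (c * (b - a)))) := by
    have h1 : ContinuousWithinAt u (Ioo a b) a :=
      (hu a (left_mem_Icc.2 hab)).mono Ioo_subset_Icc_self
    have h2 : Continuous fun s => Real.exp (c * (b - s)) := by fun_prop
    exact Tendsto.mul h1 (h2.continuousWithinAt)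
  have : (𝓝[Ioo a b] a).NeBot := by
    rw [nhdsWithin_Ioo_eq_nhdsGT hlt]
    infer_instance
  exact ge_of_tendsto htend (eventually_of_mem self_mem_nhdsWithin hin)

/-- Exponential growth bound from a bound on the lower right Dini derivative that may fail at
finitely many points. -/
lemma le_mul_exp_of_dini_off_finite {u : ℝ → ℝ} {c : ℝ} {D : Set ℝ} (hD : D.Finite) :
    ∀ {a b : ℝ}, a ≤ b → ContinuousOn u (Icc a b) →
    (∀ t ∈ Ioo a b, t ∉ D → ∀ r, c * u t < r → ∃ᶠ z in 𝓝[>] t, (z - t)⁻¹ * (u z - u t) < r) →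
    u b ≤ u a * Real.exp (c * (b - a)) := by
  induction D, hD using Set.Finite.induction_on with
  | empty => exact fun hab hu h => le_mul_exp_of_dini hab hu fun t ht => h t ht (notMem_empty t)
  | @insert d D _ _ ih =>
    intro a b hab hu h
    by_cases hd : d ∈ Ioo a b
    · have h1 := ih hd.1.le (hu.mono (Icc_subset_Icc_right hd.2.le)) fun t ht htD =>
        h t ⟨ht.1, ht.2.trans hd.2⟩ (by simp [htD, ht.2.ne])
      have h2 := ih hd.2.le (hu.mono (Icc_subset_Icc_left hd.1.le)) fun t ht htD =>
        h t ⟨hd.1.trans ht.1, ht.2⟩ (by simp [htD, ht.1.ne'])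
      calc u b ≤ u d * Real.exp (c * (b - d)) := h2
        _ ≤ u a * Real.exp (c * (d - a)) * Real.exp (c * (b - d)) := by gcongr
        _ = u a * Real.exp (c * (b - a)) := by
          rw [mul_assoc, ← Real.exp_add]
          ring_nf
    · refine ih hab hu fun t ht htD => h t ht ?_
      rintro (rfl | h')
      exacts [hd ht, htD h']

/-- A curve whose Euler steps grow at rate at most `c`, away from finitely many times, has norm
growing at exponential rate at most `c`. -/
lemma norm_le_mul_exp_of_euler {X : Type*} [NormedAddCommGroup X] [NormedSpace ℝ X]
    {d d' : ℝ → X} {c a b : ℝ} {D : Set ℝ} (hD : D.Finite) (hab : a ≤ b)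
    (hd : ContinuousOn d (Icc a b))
    (hderiv : ∀ t ∈ Ioo a b, t ∉ D → HasDerivAt d (d' t) t)
    (heuler : ∀ t ∈ Ioo a b, t ∉ D →
      ∀ᶠ s in 𝓝[>] (0 : ℝ), ‖d t + s • d' t‖ ≤ (1 + s * c) * ‖d t‖) :
    ‖d b‖ ≤ ‖d a‖ * Real.exp (c * (b - a)) := by
  refine le_mul_exp_of_dini_off_finite (u := fun t => ‖d t‖) hD hab hd.norm ?_
  intro t ht htD r hr
  refine Eventually.frequently ?_
  have hmap : Tendsto (fun z => z - t) (𝓝[>] t) (𝓝[>] 0) := by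
    refine tendsto_nhdsWithin_iff.2 ⟨?_, ?_⟩
    · have : Tendsto (fun z => z - t) (𝓝 t) (𝓝 (t - t)) := tendsto_id.sub_const t
      rw [sub_self] at this
      exact this.mono_left nhdsWithin_le_nhds
    · exact eventually_of_mem self_mem_nhdsWithin fun z hz => mem_Ioi.2 (sub_pos.2 hz)
  -- Half of the gap is given to the remainder of the first-order expansion; the other half keeps
  -- the final inequality strict.
  have hη : 0 < (r - c * ‖d t‖) / 2 := by linarith
  have hlit := (hasDerivAt_iff_isLittleO.1 (hderiv t ht htD)).def hη
  filter_upwards [hmap.eventually (heuler t ht htD), nhdsWithin_le_nhds hlit,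
    self_mem_nhdsWithin] with z hz1 hz2 hz3
  have hpos : 0 < z - t := sub_pos.2 hz3
  rw [Real.norm_of_nonneg hpos.le] at hz2
  have h3 : ‖d z‖ ≤ ‖d t + (z - t) • d' t‖ + ‖d z - d t - (z - t) • d' t‖ := by
    have := norm_add_le (d t + (z - t) • d' t) (d z - d t - (z - t) • d' t)
    rwa [sub_sub, add_sub_cancel, ← sub_sub] at this
  rw [inv_mul_lt_iff₀ hpos]
  nlinarith

end GronwallWithExceptions

/-! ### Infinitesimal growth in the weighted maximum norm. -/

section WeightedNorm

variable {m : ℕ} {E : Fin m → Type*} [∀ i, NormedAddCommGroup (E i)] [∀ i, NormedSpace ℝ (E i)]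

/-- Rescaling of the `i`-th component by `(u i)⁻¹`. The norm of the rescaled vector is the weighted
maximum norm of the vector. -/
noncomputable def rescale (u : Fin m → ℝ) : (∀ i, E i) →L[ℝ] (∀ i, E i) :=
  ContinuousLinearMap.pi fun i => (u i)⁻¹ • ContinuousLinearMap.proj i

lemma rescale_apply (u : Fin m → ℝ) (z : ∀ i, E i) (i : Fin m) :
    rescale u z i = (u i)⁻¹ • z i := rfl

lemma norm_apply_le_mul_norm_rescale {u : Fin m → ℝ} (hu : ∀ i, 0 < u i) (z : ∀ i, E i)
    (i : Fin m) : ‖z i‖ ≤ u i * ‖rescale u z‖ := by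
  have h := norm_le_pi_norm (rescale u z) i
  rwa [rescale_apply, norm_smul, norm_inv, Real.norm_of_nonneg (hu i).le,
    inv_mul_le_iff₀ (hu i)] at h

lemma norm_rescale_le {u : Fin m → ℝ} (hu : ∀ i, 0 < u i) {z : ∀ i, E i} {r : ℝ} (hr : 0 ≤ r)
    (h : ∀ i, ‖z i‖ ≤ u i * r) : ‖rescale u z‖ ≤ r := by
  refine (pi_norm_le_iff_of_nonneg hr).2 fun i => ?_
  rw [rescale_apply, norm_smul, norm_inv, Real.norm_of_nonneg (hu i).le, inv_mul_le_iff₀ (hu i)]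
  exact h i

lemma norm_le_sum_mul_norm_rescale {u : Fin m → ℝ} (hu : ∀ i, 0 < u i) (z : ∀ i, E i) :
    ‖z‖ ≤ (∑ i, u i) * ‖rescale u z‖ := by
  have hsum : 0 ≤ ∑ i, u i := Finset.sum_nonneg fun i _ => (hu i).le
  refine (pi_norm_le_iff_of_nonneg (by positivity)).2 fun i => ?_
  refine (norm_apply_le_mul_norm_rescale hu z i).trans ?_
  gcongr
  exact Finset.single_le_sum (f := u) (fun j _ => (hu j).le) (Finset.mem_univ i)

lemma fderiv_apply_eq_sum_jacobianBlock (f : ℝ → (∀ i, E i) → (∀ i, E i)) (t : ℝ)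
    (v z : ∀ i, E i) (i : Fin m) :
    fderiv ℝ (f t) v z i = ∑ j, jacobianBlock f t v i j (z j) := by
  conv_lhs => rw [← Finset.univ_sum_single z]
  rw [map_sum, Finset.sum_apply]
  rfl

lemma continuous_jacobianBlock {f : ℝ → (∀ i, E i) → (∀ i, E i)} {t : ℝ}
    (hf : ContDiff ℝ 1 (f t)) (i j : Fin m) : Continuous fun v => jacobianBlock f t v i j := by
  have := hf.continuous_fderiv one_ne_zero
  unfold jacobianBlock
  fun_prop

variable [∀ i, Nontrivial (E i)]

/-- If the interconnection matrices along the segment from `x` to `y` are dominated by `B`, small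
Euler steps of the difference grow at most at the rate `c` of a positive subeigenvector of `B`, in
the corresponding weighted maximum norm. -/
lemma eventually_norm_rescale_euler_le {f : ℝ → (∀ i, E i) → (∀ i, E i)} {t : ℝ}
    (hf : ContDiff ℝ 1 (f t)) {x y : ∀ i, E i} {B : Matrix (Fin m) (Fin m) ℝ} {u : Fin m → ℝ}
    (hu : ∀ i, 0 < u i) {c : ℝ} (hc : 0 ≤ c) (hBu : ∀ i, ∑ j, B i j * u j ≤ c * u i)
    (hB : ∀ v ∈ segment ℝ x y, ∀ i j, interconnectionMatrix f t v i j < B i j) :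
    ∀ᶠ s in 𝓝[>] (0 : ℝ), ‖rescale u (y - x) + s • rescale u (f t y - f t x)‖
      ≤ (1 + s * c) * ‖rescale u (y - x)‖ := by
  have hdiag : ∀ i, ∀ v ∈ segment ℝ x y, matrixMeasure (jacobianBlock f t v i i) < B i i := by
    intro i v hv
    simpa [interconnectionMatrix] using hB v hv i i
  have hoff : ∀ i j, i ≠ j → ∀ v ∈ segment ℝ x y, ‖jacobianBlock f t v i j‖ ≤ B i j := by
    intro i j hij v hv
    have := hB v hv i j
    simp only [interconnectionMatrix, Matrix.of_apply, if_neg hij] at this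
    exact this.le
  have hcompact : IsCompact (segment ℝ x y) := by
    rw [segment_eq_image_lineMap]
    exact isCompact_Icc.image AffineMap.lineMap_continuous
  -- The admissible step size is locally uniform in the Jacobian block; compactness of the segment
  -- makes it uniform.
  have hunif : ∀ i, ∃ r > 0, ∀ v ∈ segment ℝ x y, ∀ s ∈ Ioc (0 : ℝ) r,
      ‖ContinuousLinearMap.id ℝ (E i) + s • jacobianBlock f t v i i‖ ≤ 1 + s * B i i := by
    intro i
    refine hcompact.induction_on (p := fun S => ∃ r > 0, ∀ v ∈ S, ∀ s ∈ Ioc (0 : ℝ) r,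
      ‖ContinuousLinearMap.id ℝ (E i) + s • jacobianBlock f t v i i‖ ≤ 1 + s * B i i)
      ⟨1, one_pos, by simp⟩ ?_ ?_ ?_
    · rintro S S' hS ⟨r, hr, h⟩
      exact ⟨r, hr, fun v hv => h v (hS hv)⟩
    · rintro S S' ⟨r, hr, h⟩ ⟨r', hr', h'⟩
      refine ⟨min r r', lt_min hr hr', ?_⟩
      rintro v (hv | hv) s hs
      · exact h v hv s ⟨hs.1, hs.2.trans (min_le_left _ _)⟩
      · exact h' v hv s ⟨hs.1, hs.2.trans (min_le_right _ _)⟩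
    · intro v hv
      obtain ⟨r, hr, h⟩ := exists_forall_norm_id_add_smul_le (hdiag i v hv)
      exact ⟨_, nhdsWithin_le_nhds
        ((continuous_jacobianBlock hf i i).continuousAt.eventually h), r, hr, fun v' hv' => hv'⟩
  choose r hr hstep using hunif
  have hev : ∀ᶠ s in 𝓝[>] (0 : ℝ), ∀ i, s ∈ Ioc 0 (r i) :=
    eventually_all.2 fun i => Ioc_mem_nhdsGT (hr i)
  filter_upwards [hev, self_mem_nhdsWithin] with s hs hs0
  have hs0' : (0 : ℝ) < s := hs0
  rw [← map_smul, ← map_add]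
  set N := ‖rescale u (y - x)‖ with hN
  have hN0 : 0 ≤ N := norm_nonneg _
  refine norm_rescale_le hu (by positivity) fun i => ?_
  have hmem : ∀ θ ∈ Icc (0 : ℝ) 1, AffineMap.lineMap x y θ ∈ segment ℝ x y := by
    intro θ hθ
    rw [segment_eq_image_lineMap]
    exact mem_image_of_mem _ hθ
  -- The increment of F over [0, 1] is the i-th component of the Euler step. Keeping the identity
  -- inside F makes ‖I + s J_ii‖ appear in the mean value inequality, rather than 1 + s ‖J_ii‖, so
  -- the matrix measure is what counts.
  set F : ℝ → E i := fun θ =>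
    AffineMap.lineMap x y θ i + s • f t (AffineMap.lineMap x y θ) i with hF
  have hFd : ∀ θ, HasDerivAt F
      ((y - x) i + s • fderiv ℝ (f t) (AffineMap.lineMap x y θ) (y - x) i) θ := by
    intro θ
    have h1 : HasDerivAt (fun θ : ℝ => AffineMap.lineMap x y θ) (y - x) θ :=
      AffineMap.hasDerivAt_lineMap
    have h2 := ((hf.differentiable one_ne_zero).differentiableAt
      (x := AffineMap.lineMap x y θ)).hasFDerivAt.comp_hasDerivAt θ h1
    exact (hasDerivAt_pi.1 h1 i).add ((hasDerivAt_pi.1 h2 i).const_smul s)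
  have hmv := norm_image_sub_le_of_norm_deriv_le_segment_01' (f := F)
    (C := u i * ((1 + s * c) * N)) (fun θ _ => (hFd θ).hasDerivWithinAt) ?_
  · convert hmv using 2
    simp only [hF, AffineMap.lineMap_apply_one, AffineMap.lineMap_apply_zero, Pi.add_apply,
      Pi.sub_apply, Pi.smul_apply, smul_sub]
    abel
  intro θ hθ
  have hv := hmem θ (Ico_subset_Icc_self hθ)
  set v := AffineMap.lineMap x y θ
  have hcomp : ∀ j, ‖(y - x) j‖ ≤ u j * N := norm_apply_le_mul_norm_rescale hu (y - x)
  rw [fderiv_apply_eq_sum_jacobianBlock, ← Finset.add_sum_erase _ _ (Finset.mem_univ i), smul_add,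
    ← add_assoc]
  have hdiagstep : ‖(y - x) i + s • jacobianBlock f t v i i ((y - x) i)‖
      ≤ (1 + s * B i i) * (u i * N) := by
    have h1 := (ContinuousLinearMap.id ℝ (E i) + s • jacobianBlock f t v i i).le_opNorm ((y - x) i)
    have h2 := hstep i v hv s (hs i)
    refine h1.trans (mul_le_mul h2 (hcomp i) (norm_nonneg _) ((norm_nonneg _).trans h2))
  have hoffstep : ‖s • ∑ j ∈ Finset.univ.erase i, jacobianBlock f t v i j ((y - x) j)‖
      ≤ s * ∑ j ∈ Finset.univ.erase i, B i j * (u j * N) := by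
    rw [norm_smul, Real.norm_of_nonneg hs0'.le]
    gcongr
    refine norm_sum_le_of_le _ fun j hj => ?_
    have h2 := hoff i j (Finset.ne_of_mem_erase hj).symm v hv
    exact ((jacobianBlock f t v i j).le_opNorm _).trans
      (mul_le_mul h2 (hcomp j) (norm_nonneg _) ((norm_nonneg _).trans h2))
  have hsum : B i i * (u i * N) + ∑ j ∈ Finset.univ.erase i, B i j * (u j * N)
      ≤ c * u i * N := by
    rw [Finset.add_sum_erase _ (fun j => B i j * (u j * N)) (Finset.mem_univ i)]
    refine le_trans (le_of_eq ?_) (mul_le_mul_of_nonneg_right (hBu i) hN0)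
    rw [Finset.sum_mul]
    exact Finset.sum_congr rfl fun j _ => by ring
  calc _ ≤ (1 + s * B i i) * (u i * N)
        + s * ∑ j ∈ Finset.univ.erase i, B i j * (u j * N) :=
      norm_add_le_of_le hdiagstep hoffstep
    _ = u i * N + s * (B i i * (u i * N)
        + ∑ j ∈ Finset.univ.erase i, B i j * (u j * N)) := by ring
    _ ≤ u i * N + s * (c * u i * N) := by gcongr
    _ = u i * ((1 + s * c) * N) := by ring

end WeightedNorm

/-! ### Lipschitz dependence on initial states in finite time. -/

section Flow

variable {V : Type*} [NormedAddCommGroup V] [NormedSpace ℝ V] {f : ℝ → V → V} {t₀ : ℝ}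

/-- The flow picks one solution per initial state; the estimates below concern these picks only, so
no uniqueness statement is needed first. -/
lemma IsForwardCompleteSystem.isSolution_flow (hf : IsForwardCompleteSystem f t₀) (x : V) :
    IsSolution f t₀ x (fun t => flow f t₀ t x) := by
  have h := hf.exists_solution x
  simp only [flow, dif_pos h]
  exact h.choose_spec

/-- Off finitely many times of each bounded interval, the difference of two trajectories satisfies
the difference equation. -/
lemma IsForwardCompleteSystem.exists_finite_hasDerivAt_sub (hf : IsForwardCompleteSystem f t₀)
    (x y : V) (b : ℝ) : ∃ D : Set ℝ, D.Finite ∧ ∀ t ∈ Ioo t₀ b, t ∉ D →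
      HasDerivAt (fun t => flow f t₀ t y - flow f t₀ t x)
        (f t (flow f t₀ t y) - f t (flow f t₀ t x)) t := by
  obtain ⟨-, -, D, hD, hx⟩ := hf.isSolution_flow x
  obtain ⟨-, -, D', hD', hy⟩ := hf.isSolution_flow y
  refine ⟨(D ∩ Icc t₀ b) ∪ (D' ∩ Icc t₀ b), (hD b).union (hD' b), fun t ht htD => ?_⟩
  have hI : t ∈ Icc t₀ b := Ioo_subset_Icc_self ht
  exact (hy t ht.1 fun h => htD (Or.inr ⟨h, hI⟩)).sub (hx t ht.1 fun h => htD (Or.inl ⟨h, hI⟩))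

lemma IsForwardCompleteSystem.continuousOn_flow_sub (hf : IsForwardCompleteSystem f t₀) (x y : V) :
    ContinuousOn (fun t => flow f t₀ t y - flow f t₀ t x) (Ici t₀) :=
  (hf.isSolution_flow y).2.1.sub (hf.isSolution_flow x).2.1

lemma IsForwardCompleteSystem.flow_self (hf : IsForwardCompleteSystem f t₀) (x : V) :
    flow f t₀ t₀ x = x := (hf.isSolution_flow x).1

/-- The Jacobian is bounded on bounded sets of times and states. -/
lemma IsForwardCompleteSystem.exists_norm_fderiv_le [ProperSpace V]
    (hf : IsForwardCompleteSystem f t₀) (b R : ℝ) :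
    ∃ L, 0 ≤ L ∧ ∀ t ∈ Icc t₀ b, ∀ x ∈ Metric.closedBall (0 : V) R, ‖fderiv ℝ (f t) x‖ ≤ L := by
  -- Times near t split into later, equal and earlier ones. One-sided limits bound the Jacobian on
  -- the first and last; they say nothing about time t itself, where continuity in x is used. At t =
  -- t₀ there are no earlier times.
  have hlocal : ∀ q ∈ Icc t₀ b ×ˢ Metric.closedBall (0 : V) R,
      ∃ S ∈ 𝓝[Icc t₀ b ×ˢ Metric.closedBall (0 : V) R] q,
        ∃ L, 0 ≤ L ∧ ∀ p ∈ S, ‖fderiv ℝ (f p.1) p.2‖ ≤ L := by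
    rintro ⟨t, x⟩ ⟨ht, -⟩
    obtain ⟨D, -, -, hright, hleft⟩ := hf.piecewiseContinuous_fderiv
    have hbdd : ∀ {l : Filter (ℝ × V)} {A : V →L[ℝ] V},
        Tendsto (fun q : ℝ × V => fderiv ℝ (f q.1) q.2) l (𝓝 A) →
        ∃ L, 0 ≤ L ∧ ∀ᶠ p in l, ‖fderiv ℝ (f p.1) p.2‖ ≤ L := fun {l A} h =>
      ⟨‖A‖ + 1, by positivity, (h.norm.eventually_lt_const (lt_add_one _)).mono fun _ => le_of_lt⟩
    obtain ⟨A₁, hA₁⟩ := hright t ht.1 x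
    obtain ⟨L₁, hL₁, h₁⟩ := hbdd hA₁
    have hA₂ : Tendsto (fun q : ℝ × V => fderiv ℝ (f q.1) q.2) (pure t ×ˢ 𝓝 x)
        (𝓝 (fderiv ℝ (f t) x)) := by
      rw [pure_prod, tendsto_map'_iff]
      exact ((hf.contDiff t ht.1).continuous_fderiv one_ne_zero).tendsto x
    obtain ⟨L₂, hL₂, h₂⟩ := hbdd hA₂
    obtain ⟨L₃, hL₃, h₃⟩ : ∃ L, 0 ≤ L ∧
        ∀ᶠ p in 𝓝[Ico t₀ t] t ×ˢ 𝓝 x, ‖fderiv ℝ (f p.1) p.2‖ ≤ L := by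
      rcases ht.1.eq_or_lt with rfl | hlt
      · exact ⟨0, le_rfl, by simp⟩
      · obtain ⟨A₃, hA₃⟩ := hleft t hlt x
        obtain ⟨L₃, hL₃, h₃⟩ := hbdd hA₃
        exact ⟨L₃, hL₃, h₃.filter_mono
          (prod_mono_left _ (nhdsWithin_mono _ fun z hz => hz.2))⟩
    set L := max L₁ (max L₂ L₃)
    refine ⟨{p | ‖fderiv ℝ (f p.1) p.2‖ ≤ L}, ?_, L, hL₁.trans (le_max_left _ _), fun p hp => hp⟩
    have hle : 𝓝[Icc t₀ b ×ˢ Metric.closedBall (0 : V) R] (t, x)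
        ≤ (𝓝[>] t ⊔ (pure t ⊔ 𝓝[Ico t₀ t] t)) ×ˢ 𝓝 x := by
      rw [nhdsWithin_prod_eq]
      refine prod_mono ?_ nhdsWithin_le_nhds
      rw [← nhdsWithin_singleton, ← nhdsWithin_union, ← nhdsWithin_union]
      refine nhdsWithin_mono _ fun z hz => ?_
      rcases lt_trichotomy z t with h | h | h
      · exact Or.inr (Or.inr ⟨hz.1, h⟩)
      · exact Or.inr (Or.inl h)
      · exact Or.inl h
    refine hle ?_
    rw [sup_prod, sup_prod]
    refine ⟨h₁.mono fun p hp => hp.trans (le_max_left _ _),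
      h₂.mono fun p hp => hp.trans ((le_max_left _ _).trans (le_max_right _ _)),
      h₃.mono fun p hp => hp.trans ((le_max_right _ _).trans (le_max_right _ _))⟩
  obtain ⟨L, hL, h⟩ := (isCompact_Icc.prod (isCompact_closedBall (0 : V) R)).induction_on
    (p := fun S => ∃ L, 0 ≤ L ∧ ∀ p ∈ S, ‖fderiv ℝ (f p.1) p.2‖ ≤ L)
    ⟨0, le_rfl, by simp⟩
    (fun S S' hS ⟨L, hL, h⟩ => ⟨L, hL, fun p hp => h p (hS hp)⟩)
    (fun S S' ⟨L, hL, h⟩ ⟨L', hL', h'⟩ => ⟨max L L', hL.trans (le_max_left _ _), fun p hp =>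
      hp.elim (fun hp => (h p hp).trans (le_max_left _ _))
        (fun hp => (h' p hp).trans (le_max_right _ _))⟩) hlocal
  exact ⟨L, hL, fun t ht x hx => h (t, x) ⟨ht, hx⟩⟩

/-- Trajectories diverge at most exponentially as long as they stay in a ball with bounded
Jacobian. -/
lemma IsForwardCompleteSystem.norm_flow_sub_le (hf : IsForwardCompleteSystem f t₀) {b R L : ℝ}
    (hb : t₀ ≤ b)
    (hL : ∀ t ∈ Icc t₀ b, ∀ x ∈ Metric.closedBall (0 : V) R, ‖fderiv ℝ (f t) x‖ ≤ L) {x y : V}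
    (hx : ∀ t ∈ Ioo t₀ b, ‖flow f t₀ t x‖ ≤ R) (hy : ∀ t ∈ Ioo t₀ b, ‖flow f t₀ t y‖ ≤ R) :
    ‖flow f t₀ b y - flow f t₀ b x‖ ≤ ‖y - x‖ * Real.exp (L * (b - t₀)) := by
  obtain ⟨D, hD, hderiv⟩ := hf.exists_finite_hasDerivAt_sub x y b
  have h := norm_le_mul_exp_of_euler (c := L) hD hb
    ((hf.continuousOn_flow_sub x y).mono Icc_subset_Ici_self) hderiv ?_
  · simpa only [hf.flow_self] using h
  intro t ht _
  filter_upwards [self_mem_nhdsWithin] with s hs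
  have hs' : (0 : ℝ) < s := hs
  have hI : t ∈ Icc t₀ b := Ioo_subset_Icc_self ht
  have hlip : ‖f t (flow f t₀ t y) - f t (flow f t₀ t x)‖ ≤ L * ‖flow f t₀ t y - flow f t₀ t x‖ :=
    (convex_closedBall (0 : V) R).norm_image_sub_le_of_norm_fderiv_le
      (fun z _ => (hf.contDiff t hI.1).differentiable one_ne_zero z) (hL t hI)
      (by simpa using hx t ht) (by simpa using hy t ht)
  calc _ ≤ ‖flow f t₀ t y - flow f t₀ t x‖ + s * (L * ‖flow f t₀ t y - flow f t₀ t x‖) := by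
        refine norm_add_le_of_le le_rfl ?_
        rw [norm_smul, Real.norm_of_nonneg hs'.le]
        gcongr
    _ = _ := by ring

/-- The trajectories from a compact set stay bounded in finite time. -/
lemma IsForwardCompleteSystem.exists_norm_flow_le [ProperSpace V]
    (hf : IsForwardCompleteSystem f t₀) {K : Set V} (hK : IsCompact K) (b : ℝ) :
    ∃ R, ∀ x ∈ K, ∀ t ∈ Icc t₀ b, ‖flow f t₀ t x‖ ≤ R := by
  refine hK.induction_on (p := fun S => ∃ R, ∀ x ∈ S, ∀ t ∈ Icc t₀ b, ‖flow f t₀ t x‖ ≤ R)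
    ⟨0, by simp⟩ (fun S S' hS ⟨R, h⟩ => ⟨R, fun x hx => h x (hS hx)⟩)
    (fun S S' ⟨R, h⟩ ⟨R', h'⟩ => ⟨max R R', fun x hx t ht =>
      hx.elim (fun hx => (h x hx t ht).trans (le_max_left _ _))
        (fun hx => (h' x hx t ht).trans (le_max_right _ _))⟩) ?_
  intro x _
  obtain ⟨R, hR⟩ := isCompact_Icc.exists_bound_of_continuousOn
    ((hf.isSolution_flow x).2.1.mono (Icc_subset_Ici_self : Icc t₀ b ⊆ Ici t₀))
  -- The ball of radius R + 1 contains the unit tube around the trajectory of x. The initial radius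
  -- exp(-L (b - t₀)) is such that growth at rate L cannot bring the distance to 1 before b.
  obtain ⟨L, hL0, hL⟩ := hf.exists_norm_fderiv_le b (R + 1)
  have hball : Metric.ball x (Real.exp (-(L * (b - t₀)))) ∈ 𝓝[K] x :=
    nhdsWithin_le_nhds (Metric.ball_mem_nhds x (Real.exp_pos _))
  refine ⟨_, hball, R + 1, fun y hy => ?_⟩
  suffices hclose : ∀ t ∈ Icc t₀ b, ‖flow f t₀ t y - flow f t₀ t x‖ < 1 by
    intro t ht
    have h1 := norm_add_le (flow f t₀ t x) (flow f t₀ t y - flow f t₀ t x)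
    rw [add_sub_cancel] at h1
    linarith [hR t ht, hclose t ht]
  by_contra! hfar
  obtain ⟨t₁, ht₁, hfar₁⟩ := hfar
  have hcont : ContinuousOn (fun t => ‖flow f t₀ t y - flow f t₀ t x‖) (Icc t₀ b) :=
    (hf.continuousOn_flow_sub x y).norm.mono Icc_subset_Ici_self
  have hcompact : IsCompact (Icc t₀ b ∩ (fun t => ‖flow f t₀ t y - flow f t₀ t x‖) ⁻¹' Ici 1) :=
    isCompact_Icc.of_isClosed_subset (hcont.preimage_isClosed_of_isClosed isClosed_Icc isClosed_Ici)
      inter_subset_left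
  -- At the first exit time τ from the tube the Jacobian bound has been valid throughout, so the
  -- distance is still below 1, a contradiction.
  obtain ⟨τ, ⟨hτ, hτ1⟩, hmin⟩ := hcompact.exists_isLeast ⟨t₁, ht₁, hfar₁⟩
  have hbefore : ∀ t ∈ Ioo t₀ τ, ‖flow f t₀ t y - flow f t₀ t x‖ < 1 := by
    intro t ht
    by_contra! h
    exact ht.2.not_ge (hmin ⟨⟨ht.1.le, ht.2.le.trans hτ.2⟩, h⟩)
  have hsub : ∀ t ∈ Ioo t₀ τ, t ∈ Icc t₀ b := fun t ht => ⟨ht.1.le, ht.2.le.trans hτ.2⟩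
  have h := hf.norm_flow_sub_le hτ.1 (R := R + 1) (L := L)
    (fun t ht => hL t ⟨ht.1, ht.2.trans hτ.2⟩) (x := x) (y := y)
    (fun t ht => (hR t (hsub t ht)).trans (by linarith)) (fun t ht => by
      have h1 := norm_add_le (flow f t₀ t x) (flow f t₀ t y - flow f t₀ t x)
      rw [add_sub_cancel] at h1
      linarith [hR t (hsub t ht), hbefore t ht])
  have hy' : ‖y - x‖ < Real.exp (-(L * (b - t₀))) := by rwa [mem_ball_iff_norm] at hy
  have h2 : ‖y - x‖ * Real.exp (L * (τ - t₀)) < 1 := by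
    calc ‖y - x‖ * Real.exp (L * (τ - t₀))
        < Real.exp (-(L * (b - t₀))) * Real.exp (L * (τ - t₀)) := by gcongr
      _ = Real.exp (L * (τ - b)) := by
        rw [← Real.exp_add]
        ring_nf
      _ ≤ 1 := Real.exp_le_one_iff.2 (mul_nonpos_of_nonneg_of_nonpos hL0 (by linarith [hτ.2]))
  have h3 : (1 : ℝ) ≤ ‖flow f t₀ τ y - flow f t₀ τ x‖ := hτ1
  linarith

/-- The flow is Lipschitz on compact sets, uniformly in finite time. -/
lemma IsForwardCompleteSystem.exists_norm_flow_sub_le [ProperSpace V]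
    (hf : IsForwardCompleteSystem f t₀) {K : Set V} (hK : IsCompact K) (b : ℝ) :
    ∃ C, 0 < C ∧ ∀ x ∈ K, ∀ y ∈ K, ∀ t ∈ Icc t₀ b,
      ‖flow f t₀ t y - flow f t₀ t x‖ ≤ C * ‖y - x‖ := by
  obtain ⟨R, hR⟩ := hf.exists_norm_flow_le hK b
  obtain ⟨L, hL0, hL⟩ := hf.exists_norm_fderiv_le b R
  refine ⟨Real.exp (L * (b - t₀)), Real.exp_pos _, fun x hx y hy t ht => ?_⟩
  have hsub : ∀ s ∈ Ioo t₀ t, s ∈ Icc t₀ b := fun s hs => ⟨hs.1.le, hs.2.le.trans ht.2⟩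
  refine (hf.norm_flow_sub_le ht.1 (fun s hs => hL s ⟨hs.1, hs.2.trans ht.2⟩)
    (fun s hs => hR x hx s (hsub s hs)) (fun s hs => hR y hy s (hsub s hs))).trans ?_
  rw [mul_comm]
  gcongr
  exact ht.2

end Flow

/-! ### Nets in compact sets. -/

section Covering

variable {V : Type*} [NormedAddCommGroup V] [NormedSpace ℝ V] [FiniteDimensional ℝ V]

/-- Allows the entropy, defined with `p`, to be bounded above by estimates in the ambient norm. -/
lemma Seminorm.exists_le_mul_norm_of_finiteDimensional (p : Seminorm ℝ V) :
    ∃ P, 0 < P ∧ ∀ z, p z ≤ P * ‖z‖ := by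
  set b := Module.finBasis ℝ V
  set φ : V →L[ℝ] (Fin (Module.finrank ℝ V) → ℝ) := LinearMap.toContinuousLinearMap b.equivFun
  have hsum : 0 ≤ ∑ k, p (b k) := Finset.sum_nonneg fun k _ => apply_nonneg p _
  refine ⟨‖φ‖ * ∑ k, p (b k) + 1, by positivity, fun z => ?_⟩
  have h1 : p z ≤ ∑ k, p (φ z k • b k) := by
    conv_lhs => rw [← b.sum_equivFun z]
    exact Finset.le_sum_of_subadditive p (map_zero p).le (map_add_le_add p) _ _
  have h2 : ∀ k, p (φ z k • b k) ≤ ‖φ‖ * ‖z‖ * p (b k) := fun k => by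
    rw [map_smul_eq_mul]
    gcongr
    exact (norm_le_pi_norm (φ z) k).trans (φ.le_opNorm z)
  calc p z ≤ ∑ k, ‖φ‖ * ‖z‖ * p (b k) := h1.trans (Finset.sum_le_sum fun k _ => h2 k)
    _ = (‖φ‖ * ∑ k, p (b k)) * ‖z‖ := by rw [← Finset.mul_sum]; ring
    _ ≤ _ := by gcongr; linarith

/-- A compact set in dimension `n` has `r`-nets of cardinality `O(r⁻ⁿ)`. -/
lemma IsCompact.exists_net_encard_le {K : Set V} (hK : IsCompact K) :
    ∃ C : ℝ, 0 < C ∧ ∀ r ∈ Ioc (0 : ℝ) 1, ∃ S ⊆ K, (∀ y ∈ K, ∃ x ∈ S, ‖y - x‖ < r) ∧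
      ∃ k : ℕ, S.encard ≤ k ∧ (k : ℝ) ≤ C * r⁻¹ ^ Module.finrank ℝ V := by
  set n := Module.finrank ℝ V
  set φ : V ≃L[ℝ] (Fin n → ℝ) := (Module.finBasis ℝ V).equivFun.toContinuousLinearEquiv
  obtain ⟨R, hR⟩ := hK.exists_bound_of_continuousOn φ.continuous.continuousOn
  set Q : ℝ := ‖(φ.symm : (Fin n → ℝ) →L[ℝ] V)‖ + 1
  have hQ : 0 < Q := by positivity
  -- With N = ⌈|R| Q / r⌉ one has 2N + 1 ≤ 2 |R| Q / r + 3, and 1 ≤ 1 / r absorbs the constant 3.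
  refine ⟨(2 * |R| * Q + 3) ^ n, by positivity, fun r hr => ?_⟩
  have hr0 : 0 < r := hr.1
  set s := r / Q with hs
  have hs0 : 0 < s := by positivity
  -- Grid of mesh s in coordinates. Choosing one point of K in each occupied cell keeps the net
  -- inside K.
  set cell : V → Fin n → ℤ := fun z k => ⌊φ z k / s⌋
  obtain ⟨S, hSK, hS⟩ := exists_subset_bijOn K cell
  refine ⟨S, hSK, fun y hy => ?_, ?_⟩
  · obtain ⟨x, hxS, hx⟩ := hS.surjOn (mem_image_of_mem cell hy)
    refine ⟨x, hxS, ?_⟩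
    have hclose : ‖φ (y - x)‖ < s := by
      refine (pi_norm_lt_iff hs0).2 fun k => ?_
      have h := Int.abs_sub_lt_one_of_floor_eq_floor (congrFun hx k).symm
      rw [← sub_div, abs_div, abs_of_pos hs0, div_lt_one hs0] at h
      rw [map_sub]
      exact h
    calc ‖y - x‖ = ‖(φ.symm : (Fin n → ℝ) →L[ℝ] V) (φ (y - x))‖ := by simp
      _ ≤ ‖(φ.symm : (Fin n → ℝ) →L[ℝ] V)‖ * ‖φ (y - x)‖ := ContinuousLinearMap.le_opNorm _ _
      _ ≤ Q * ‖φ (y - x)‖ := by gcongr; exact le_add_of_nonneg_right zero_le_one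
      _ < Q * s := by gcongr
      _ = r := by rw [hs]; field_simp
  · set N : ℕ := ⌈|R| / s⌉₊
    set box : Finset (Fin n → ℤ) := Fintype.piFinset fun _ => Finset.Icc (-(N : ℤ)) N
    refine ⟨(2 * N + 1) ^ n, ?_, ?_⟩
    · have hsub : cell '' K ⊆ (box : Set (Fin n → ℤ)) := by
        rintro _ ⟨z, hz, rfl⟩
        rw [Finset.mem_coe, Fintype.mem_piFinset]
        intro k
        have h1 : |φ z k / s| ≤ N := by
          rw [abs_div, abs_of_pos hs0]
          refine le_trans ?_ (Nat.le_ceil _)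
          refine div_le_div_of_nonneg_right ?_ hs0.le
          exact (norm_le_pi_norm (φ z) k).trans ((hR z hz).trans (le_abs_self R))
        rw [abs_le] at h1
        rw [Finset.mem_Icc]
        refine ⟨Int.le_floor.2 (by push_cast; exact h1.1), ?_⟩
        have h2 : (⌊φ z k / s⌋ : ℝ) ≤ N := (Int.floor_le _).trans h1.2
        exact_mod_cast h2
      have hcard : box.card = (2 * N + 1) ^ n := by
        rw [Fintype.card_piFinset_const, Int.card_Icc]
        congr 1
        omega
      calc S.encard = (cell '' K).encard := by rw [← hS.image_eq, hS.injOn.encard_image]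
        _ ≤ (box : Set (Fin n → ℤ)).encard := encard_le_encard hsub
        _ = ((2 * N + 1) ^ n : ℕ) := by rw [encard_coe_eq_coe_finsetCard, hcard]
    · have hN : (N : ℝ) ≤ |R| / s + 1 := (Nat.ceil_lt_add_one (by positivity)).le
      have hr1 : 1 ≤ r⁻¹ := (one_le_inv₀ hr0).2 hr.2
      have hRs : |R| / s = |R| * Q * r⁻¹ := by rw [hs]; field_simp
      push_cast
      rw [← mul_pow]
      gcongr
      rw [hRs] at hN
      linarith

end Covering

/-! ### From exponential divergence to entropy. -/

section Entropy

variable {V : Type*} [NormedAddCommGroup V] [NormedSpace ℝ V]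

lemma spanningNumber_antitone (p : Seminorm ℝ V) (f : ℝ → V → V) (t₀ T : ℝ) (K : Set V) :
    Antitone fun ε => spanningNumber p f t₀ ε T K := by
  intro ε ε' hε
  refine sInf_le_sInf ?_
  rintro _ ⟨S, ⟨hSK, hS⟩, rfl⟩
  refine ⟨S, ⟨hSK, hS.trans ?_⟩, rfl⟩
  exact iUnion₂_mono fun x _ y hy t ht => (hy t ht).trans_le hε

/-- The limit over `ε` in the definition of the topological entropy exists. -/
lemma tendsto_topEntropy (p : Seminorm ℝ V) (f : ℝ → V → V) (t₀ : ℝ) (K : Set V) :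
    Tendsto (fun ε : ℝ => limsup (fun T : ℝ => ((1 / T : ℝ) : EReal) *
      ENNReal.log ((spanningNumber p f t₀ ε T K : ℕ∞) : ENNReal)) atTop) (𝓝[>] 0)
      (𝓝 (topEntropy p f t₀ K)) := by
  refine tendsto_nhds_limUnder ⟨_, Antitone.tendsto_nhdsGT (fun ε ε' hε => ?_) 0⟩
  refine limsup_le_limsup ?_
  filter_upwards [eventually_gt_atTop (0 : ℝ)] with T hT
  refine mul_le_mul_of_nonneg_left ?_ (EReal.coe_nonneg.2 (by positivity))
  exact ENNReal.log_monotone (ENat.toENNReal_le.2 (spanningNumber_antitone p f t₀ T K hε))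

variable [FiniteDimensional ℝ V]

/-- If distances on a compact set grow at exponential rate at most `c`, the topological entropy is
at most the dimension times `c`. -/
lemma topEntropy_le_finrank_mul {p : Seminorm ℝ V} {f : ℝ → V → V} {t₀ : ℝ} {K : Set V}
    (hK : IsCompact K) {c C : ℝ} (hc : 0 ≤ c) (hC : 0 < C)
    (h : ∀ x ∈ K, ∀ y ∈ K, ∀ t, t₀ ≤ t →
      ‖flow f t₀ t y - flow f t₀ t x‖ ≤ C * Real.exp (c * (t - t₀)) * ‖y - x‖) :
    topEntropy p f t₀ K ≤ ((Module.finrank ℝ V * c : ℝ) : EReal) := by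
  set n := Module.finrank ℝ V
  obtain ⟨P, hP, hp⟩ := p.exists_le_mul_norm_of_finiteDimensional
  obtain ⟨M, hM, hnet⟩ := hK.exists_net_encard_le
  refine le_of_tendsto (tendsto_topEntropy p f t₀ K) ?_
  filter_upwards [self_mem_nhdsWithin] with ε hε
  have hε0 : (0 : ℝ) < ε := hε
  -- The second term makes P C exp(c T) times the net radius κ exp(-c T) at most ε; the first keeps
  -- that radius in (0, 1].
  set κ : ℝ := min 1 (ε / (P * C))
  have hκ : 0 < κ := by positivity
  have hcount : ∀ T : ℝ, 0 < T → ENNReal.log ((spanningNumber p f t₀ ε T K : ℕ∞) : ENNReal)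
      ≤ ((Real.log (M * κ⁻¹ ^ n) + n * c * T : ℝ) : EReal) := by
    intro T hT
    have hr1 : κ * Real.exp (-(c * T)) ≤ 1 :=
      mul_le_one₀ (min_le_left _ _) (Real.exp_pos _).le
        (Real.exp_le_one_iff.2 (neg_nonpos.2 (by positivity)))
    obtain ⟨S, hSK, hS, k, hSk, hk⟩ := hnet (κ * Real.exp (-(c * T))) ⟨by positivity, hr1⟩
    have hspan : IsSpanning p f t₀ ε T K S := by
      refine ⟨hSK, fun y hy => ?_⟩
      obtain ⟨x, hxS, hx⟩ := hS y hy
      refine mem_iUnion₂.2 ⟨x, hxS, fun t ht => ?_⟩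
      calc p (flow f t₀ t y - flow f t₀ t x) ≤ P * ‖flow f t₀ t y - flow f t₀ t x‖ := hp _
        _ ≤ P * (C * Real.exp (c * (t - t₀)) * ‖y - x‖) := by
          gcongr
          exact h x (hSK hxS) y hy t ht.1
        _ ≤ P * (C * Real.exp (c * T) * ‖y - x‖) := by
          gcongr
          linarith [ht.2]
        _ < P * (C * Real.exp (c * T) * (κ * Real.exp (-(c * T)))) := by gcongr
        _ = P * C * κ := by
          rw [Real.exp_neg]
          field_simp
        _ ≤ P * C * (ε / (P * C)) := by
          gcongr
          exact min_le_right _ _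
        _ = ε := by field_simp
    have hle : ((spanningNumber p f t₀ ε T K : ℕ∞) : ENNReal)
        ≤ ENNReal.ofReal (M * κ⁻¹ ^ n * Real.exp (n * c * T)) := by
      have h1 : spanningNumber p f t₀ ε T K ≤ (k : ℕ∞) :=
        le_trans (sInf_le ⟨S, hspan, rfl⟩) hSk
      have h2 : ((spanningNumber p f t₀ ε T K : ℕ∞) : ENNReal) ≤ (k : ENNReal) := by
        simpa using ENat.toENNReal_le.2 h1
      refine h2.trans ?_
      rw [← ENNReal.ofReal_natCast]
      refine ENNReal.ofReal_le_ofReal (hk.trans (le_of_eq ?_))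
      rw [mul_inv, mul_pow, Real.exp_neg, inv_inv, ← Real.exp_nat_mul, ← mul_assoc, ← mul_assoc]
    refine (ENNReal.log_monotone hle).trans (le_of_eq ?_)
    rw [ENNReal.log_ofReal_of_pos (by positivity), Real.log_mul (by positivity) (by positivity),
      Real.log_exp]
  have hlim : Tendsto (fun T : ℝ => ((1 / T * (Real.log (M * κ⁻¹ ^ n) + n * c * T) : ℝ) : EReal))
      atTop (𝓝 ((n * c : ℝ) : EReal)) := by
    refine (continuous_coe_real_ereal.tendsto _).comp ?_
    have h0 : Tendsto (fun T : ℝ => T⁻¹ * Real.log (M * κ⁻¹ ^ n) + n * c) atTop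
        (𝓝 (0 * Real.log (M * κ⁻¹ ^ n) + n * c)) :=
      (tendsto_inv_atTop_zero.mul_const _).add_const _
    rw [zero_mul, zero_add] at h0
    refine h0.congr' ?_
    filter_upwards [eventually_gt_atTop (0 : ℝ)] with T hT
    field_simp
  rw [← hlim.limsup_eq]
  refine limsup_le_limsup ?_
  filter_upwards [eventually_gt_atTop (0 : ℝ)] with T hT
  rw [EReal.coe_mul]
  exact mul_le_mul_of_nonneg_left (hcount T hT) (EReal.coe_nonneg.2 (by positivity))

end Entropy

/-! ### Growth of distances in interconnected systems. -/

section InterconnectedGrowth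

variable {m : ℕ} {E : Fin m → Type*} [∀ i, NormedAddCommGroup (E i)] [∀ i, NormedSpace ℝ (E i)]
  [∀ i, Nontrivial (E i)]

/-- If the interconnection matrices along the segments between two trajectories are dominated by `B`
on `(a, b)`, the weighted distance of the trajectories grows at most at the rate `c` of a positive
subeigenvector of `B`. -/
lemma IsForwardCompleteSystem.norm_rescale_flow_sub_le
    {f : ℝ → (∀ i, E i) → (∀ i, E i)} {t₀ : ℝ} (hf : IsForwardCompleteSystem f t₀)
    {x y : ∀ i, E i} {a b : ℝ} (ha : t₀ ≤ a) (hab : a ≤ b) {B : Matrix (Fin m) (Fin m) ℝ}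
    {u : Fin m → ℝ} (hu : ∀ i, 0 < u i) {c : ℝ} (hc : 0 ≤ c)
    (hBu : ∀ i, ∑ j, B i j * u j ≤ c * u i)
    (hB : ∀ t ∈ Ioo a b, ∀ v ∈ segment ℝ (flow f t₀ t x) (flow f t₀ t y), ∀ i j,
      interconnectionMatrix f t v i j < B i j) :
    ‖rescale u (flow f t₀ b y - flow f t₀ b x)‖
      ≤ ‖rescale u (flow f t₀ a y - flow f t₀ a x)‖ * Real.exp (c * (b - a)) := by
  obtain ⟨D, hD, hderiv⟩ := hf.exists_finite_hasDerivAt_sub x y b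
  exact norm_le_mul_exp_of_euler
    (d := fun t => rescale u (flow f t₀ t y - flow f t₀ t x))
    (d' := fun t => rescale u (f t (flow f t₀ t y) - f t (flow f t₀ t x))) hD hab
    ((rescale u).continuous.comp_continuousOn ((hf.continuousOn_flow_sub x y).mono
      fun s hs => ha.trans hs.1))
    (fun s hs hsD => ((rescale u).hasFDerivAt
      (x := flow f t₀ s y - flow f t₀ s x)).comp_hasDerivAt s
        (hderiv s ⟨ha.trans_lt hs.1, hs.2⟩ hsD))
    (fun s hs _ => eventually_norm_rescale_euler_le
      (hf.contDiff s (ha.trans hs.1.le)) hu hc hBu (hB s hs))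

variable [∀ i, FiniteDimensional ℝ (E i)]

/-- Distances between trajectories of an interconnected system grow at most at each exponential
rate to the right of the spectral abscissa of an asymptotic upper bound of the interconnection
matrix functions. -/
lemma IsForwardCompleteSystem.exists_norm_flow_sub_le_exp (hm : 1 ≤ m)
    {f : ℝ → (∀ i, E i) → (∀ i, E i)} {t₀ : ℝ} (hf : IsForwardCompleteSystem f t₀)
    {K : Set (∀ i, E i)} (hK : IsCompact K) {A : Matrix (Fin m) (Fin m) ℝ} (hA : IsMetzler A)
    (hdom : ∀ i j, limsup (fun t : ℝ =>
        ⨆ v ∈ convexHull ℝ (reachableSet f t₀ K t),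
          ((interconnectionMatrix f t v i j : ℝ) : EReal)) atTop ≤ ((A i j : ℝ) : EReal))
    {c : ℝ} (hc0 : 0 ≤ c) (hc : spectralAbscissa A < c) :
    ∃ C, 0 < C ∧ ∀ x ∈ K, ∀ y ∈ K, ∀ t, t₀ ≤ t →
      ‖flow f t₀ t y - flow f t₀ t x‖ ≤ C * Real.exp (c * (t - t₀)) * ‖y - x‖ := by
  obtain ⟨u, hu, hAu⟩ := hA.exists_pos_mulVec_lt hm hc
  -- The slack δ turns the bound on the upper limit into a strict entrywise bound at all large
  -- times, at the same rate c.
  obtain ⟨δ, hδ, hBu⟩ := exists_pos_forall_mulVec_add_le hAu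
  have hev : ∀ᶠ t in atTop, ∀ i j, ∀ v ∈ convexHull ℝ (reachableSet f t₀ K t),
      interconnectionMatrix f t v i j < A i j + δ := by
    refine eventually_all.2 fun i => eventually_all.2 fun j => ?_
    have hlt : ((A i j : ℝ) : EReal) < ((A i j + δ : ℝ) : EReal) :=
      EReal.coe_lt_coe_iff.2 (lt_add_of_pos_right _ hδ)
    filter_upwards [eventually_lt_of_limsup_lt ((hdom i j).trans_lt hlt)] with t ht v hv
    exact EReal.coe_lt_coe_iff.1 ((le_iSup₂ (f := fun v _ =>
      ((interconnectionMatrix f t v i j : ℝ) : EReal)) v hv).trans_lt ht)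
  obtain ⟨t₁, ht₁⟩ := eventually_atTop.1 (hev.and (eventually_ge_atTop t₀))
  have ht₀₁ : t₀ ≤ t₁ := (ht₁ t₁ le_rfl).2
  obtain ⟨C, hC, hshort⟩ := hf.exists_norm_flow_sub_le hK t₁
  have husum : 0 ≤ ∑ i, u i := Finset.sum_nonneg fun i _ => (hu i).le
  set Q := ‖rescale (E := E) u‖
  have hQ : 0 ≤ Q := norm_nonneg _
  -- C serves up to t₁. Afterwards, Q and the sum of the weights are the costs of passing to the
  -- weighted norm at t₁ and back at t.
  refine ⟨C + (∑ i, u i) * Q * C, by positivity, fun x hx y hy t ht => ?_⟩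
  rcases le_total t t₁ with hle | hle
  · refine (hshort x hx y hy t ⟨ht, hle⟩).trans ?_
    gcongr
    have h1 : 1 ≤ Real.exp (c * (t - t₀)) :=
      Real.one_le_exp (mul_nonneg hc0 (sub_nonneg.2 ht))
    nlinarith [show 0 ≤ (∑ i, u i) * Q * C by positivity]
  · have hgrow := hf.norm_rescale_flow_sub_le (x := x) (y := y) ht₀₁ hle
      (B := Matrix.of fun i j => A i j + δ) hu hc0 hBu fun s hs v hv i j =>
        (ht₁ s hs.1.le).1 i j v (segment_subset_convexHull (mem_image_of_mem _ hx)
          (mem_image_of_mem _ hy) hv)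
    have hstart : ‖rescale u (flow f t₀ t₁ y - flow f t₀ t₁ x)‖ ≤ Q * (C * ‖y - x‖) :=
      ((rescale (E := E) u).le_opNorm _).trans
        (mul_le_mul_of_nonneg_left (hshort x hx y hy t₁ ⟨ht₀₁, le_rfl⟩) hQ)
    have hexp : Real.exp (c * (t - t₁)) ≤ Real.exp (c * (t - t₀)) :=
      Real.exp_le_exp.2 (mul_le_mul_of_nonneg_left (sub_le_sub_left ht₀₁ t) hc0)
    have hweighted : ‖rescale u (flow f t₀ t y - flow f t₀ t x)‖
        ≤ Q * (C * ‖y - x‖) * Real.exp (c * (t - t₀)) :=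
      hgrow.trans (mul_le_mul hstart hexp (Real.exp_pos _).le (by positivity))
    calc ‖flow f t₀ t y - flow f t₀ t x‖
        ≤ (∑ i, u i) * ‖rescale u (flow f t₀ t y - flow f t₀ t x)‖ :=
          norm_le_sum_mul_norm_rescale hu _
      _ ≤ (∑ i, u i) * (Q * (C * ‖y - x‖) * Real.exp (c * (t - t₀))) :=
          mul_le_mul_of_nonneg_left hweighted husum
      _ = (∑ i, u i) * Q * C * Real.exp (c * (t - t₀)) * ‖y - x‖ := by ring
      _ ≤ (C + (∑ i, u i) * Q * C) * Real.exp (c * (t - t₀)) * ‖y - x‖ := by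
          gcongr
          exact le_add_of_nonneg_left hC.le

end InterconnectedGrowth

theorem theorem2 {m : ℕ} (hm : 1 ≤ m) {E : Fin m → Type*}
    [∀ i, NormedAddCommGroup (E i)] [∀ i, NormedSpace ℝ (E i)]
    [∀ i, FiniteDimensional ℝ (E i)] [∀ i, Nontrivial (E i)]
    (p : Seminorm ℝ (∀ i, E i)) (hp : ∀ x, p x = 0 → x = 0)
    (f : ℝ → (∀ i, E i) → (∀ i, E i)) (t₀ : ℝ) (hf : IsForwardCompleteSystem f t₀)
    (K : Set (∀ i, E i)) (hK : IsCompact K) (hKint : (interior K).Nonempty)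
    (A : Matrix (Fin m) (Fin m) ℝ) (hA : IsMetzler A)
    (hdom : ∀ i j, limsup (fun t : ℝ =>
        ⨆ v ∈ convexHull ℝ (reachableSet f t₀ K t),
          ((interconnectionMatrix f t v i j : ℝ) : EReal)) atTop ≤ ((A i j : ℝ) : EReal)) :
    topEntropy p f t₀ K ≤
      (((∑ i, Module.finrank ℝ (E i) : ℕ) * max (spectralAbscissa A) 0 : ℝ) : EReal) := by
  have hcont : Continuous fun c : ℝ =>
      (((∑ i, Module.finrank ℝ (E i) : ℕ) * c : ℝ) : EReal) :=
    continuous_coe_real_ereal.comp (by fun_prop)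
  -- The subeigenvector exists only for rates strictly above the spectral abscissa, so the bound at
  -- the endpoint is reached as a limit from the right.
  refine ge_of_tendsto ((hcont.tendsto (max (spectralAbscissa A) 0)).mono_left
    (nhdsWithin_le_nhds (s := Ioi (max (spectralAbscissa A) 0)))) ?_
  filter_upwards [self_mem_nhdsWithin] with c hc
  have hc' : max (spectralAbscissa A) 0 < c := hc
  have hc0 : 0 ≤ c := (le_max_right _ _).trans hc'.le
  obtain ⟨C, hC, hgrowth⟩ :=
    hf.exists_norm_flow_sub_le_exp hm hK hA hdom hc0 ((le_max_left _ _).trans_lt hc')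
  have h := topEntropy_le_finrank_mul (p := p) hK hc0 hC hgrowth
  rwa [Module.finrank_pi_fintype] at h
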